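/- Let $d\ge 1$, let $S\subset\mathbb{R}^d$ be a finite set and let $q\in\mathbb{R}^d\setminus S$ be such that $S\cup\{q\}$ is in general position, that is, any at most $d+1$ of its points are affinely independent. Let $S_1,\dots,S_{d+1}$ be nonempty subsets of $S$. Say that $S_1,\dots,S_{d+1}$ enclose $q$ if they are pairwise disjoint and, for every choice of $p_1\in S_1,\dots,p_{d+1}\in S_{d+1}$, the point $q$ lies in the convex hull of $\{p_1,\dots,p_{d+1}\}$. Then $S_1,\dots,S_{d+1}$ enclose $q$ if and only if there are $d+1$ closed halfspaces $H_1^+,\dots,H_{d+1}^+$ of $\mathbb{R}^d$ such that (i) for every $i$, the bounding hyperplane of $H_i^+$ contains $q$ and exactly $d-1$ points of $S$; (ii) $S_i\subseteq\bigcap_{j\ne i}H_j^+$ for every $i$; (iii) $\bigcap_{i=1}^{d+1}H_i^+=\{q\}$. -/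

import Mathlib

namespace EnclosingDepth

/-- A set of points of `ℝ^d` is in general position if any at most `d + 1` of its points are
affinely independent (so no hyperplane contains more than `d` of its points). -/
def InGeneralPosition {d : ℕ} (P : Set (EuclideanSpace ℝ (Fin d))) : Prop :=
  ∀ T : Finset (EuclideanSpace ℝ (Fin d)), (T : Set (EuclideanSpace ℝ (Fin d))) ⊆ P →
    T.card ≤ d + 1 → AffineIndependent ℝ (fun x : T => (x : EuclideanSpace ℝ (Fin d)))

/-- The finite sets `A 0, …, A d` enclose `q`: they are pairwise disjoint, and `q` lies in the
convex hull of every transversal. -/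
def Encloses {d : ℕ} (A : Fin (d + 1) → Finset (EuclideanSpace ℝ (Fin d)))
    (q : EuclideanSpace ℝ (Fin d)) : Prop :=
  (∀ i j, i ≠ j → Disjoint (A i) (A j)) ∧
    ∀ p : Fin (d + 1) → EuclideanSpace ℝ (Fin d), (∀ i, p i ∈ A i) →
      q ∈ convexHull ℝ (Set.range p)

/-- A closed halfspace of `ℝ^d`, given by a nonzero inner normal vector and an offset. -/
structure ClosedHalfspace (d : ℕ) where
  normal : EuclideanSpace ℝ (Fin d)
  normal_ne_zero : normal ≠ 0
  offset : ℝ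

/-- The closed halfspace as a set of points. -/
def ClosedHalfspace.carrier {d : ℕ} (H : ClosedHalfspace d) : Set (EuclideanSpace ℝ (Fin d)) :=
  {x | H.offset ≤ inner ℝ H.normal x}

/-- The hyperplane that bounds the halfspace. -/
def ClosedHalfspace.boundary {d : ℕ} (H : ClosedHalfspace d) : Set (EuclideanSpace ℝ (Fin d)) :=
  {x | inner ℝ H.normal x = H.offset}

end EnclosingDepth

open Finset

namespace EnclosingDepth

/-! Put q at the origin. Enclosing and general position make every transversal positively dependent,
with any d of its d+1 members independent. To build H_k, drop S_k: transversals of the other sets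
are bases whose open cones contain -(z - q) for a fixed z in S_k. By Cramer's rule their
determinants all have one sign, and by multilinearity this persists on transversals of the convex
hulls. Hence 0 is not in the hull of the union, and a functional is positive on all S_i, i ≠ k
(`exists_inner_pos_of_transversals`). Rotate it until it vanishes at d-1 points, keeping it positive
at a chosen point of S_{k+1}; this cyclic strictness forces the halfspaces to meet only in q
(`eq_zero_of_cyclic_pos`). Conversely, if the halfspaces meet only in q, their normals span and are
positively dependent, so any functional is a nonpositive combination of all normals but one, n_k. It
is then nonpositive on S_k - q, so no functional separates a transversal from q
(`exists_inner_nonpos`). -/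

/-! ### Sign of an alternating form on transversals -/

/-- Replacing one argument of an alternating map by a linear combination of all arguments scales
its value by the corresponding coefficient. -/
theorem alternating_update_sum {ι E : Type*} [Fintype ι] [DecidableEq ι] [AddCommGroup E]
    [Module ℝ E] (f : E [⋀^ι]→ₗ[ℝ] ℝ) (x : ι → E) (j : ι) (c : ι → ℝ) :
    f (Function.update x j (∑ i, c i • x i)) = c j * f x := by
  have key : ∀ y, f (Function.update x j y) = f.toMultilinearMap.toLinearMap x j y :=
    fun y => rfl
  rw [key, map_sum, Finset.sum_eq_single j]
  · rw [map_smul, ← key, Function.update_eq_self, smul_eq_mul]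
  · intro i _ hij
    rw [map_smul, ← key, f.map_eq_zero_of_eq _ (i := i) (j := j) _ hij, smul_zero]
    simp [Function.update_of_ne hij]
  · simp

/-- Positivity of a multilinear form on transversals extends to transversals of the hulls. -/
theorem multilinear_pos_of_mem_convexHull {ι E : Type*} [Fintype ι] [AddCommGroup E]
    [Module ℝ E] (f : MultilinearMap ℝ (fun _ : ι => E) ℝ) (B : ι → Set E)
    (h : ∀ x : ι → E, (∀ i, x i ∈ B i) → 0 < f x) (x : ι → E)
    (hx : ∀ i, x i ∈ convexHull ℝ (B i)) : 0 < f x := by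
  classical
  have key : ∀ s : Finset ι, ∀ x : ι → E, (∀ i ∈ s, x i ∈ convexHull ℝ (B i)) →
      (∀ i ∉ s, x i ∈ B i) → 0 < f x := by
    intro s
    induction s using Finset.induction_on with
    | empty => exact fun x _ hx => h x fun i => hx i (by simp)
    | insert j s hj ih =>
      intro x h1 h2
      have hc : Convex ℝ {y | 0 < f.toLinearMap x j y} :=
        convex_halfSpace_gt (f.toLinearMap x j).isLinear 0
      have hsub : B j ⊆ {y | 0 < f.toLinearMap x j y} := by
        intro y hy
        refine ih (Function.update x j y) (fun i hi => ?_) (fun i hi => ?_)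
        · have hij : i ≠ j := fun e => hj (e ▸ hi)
          simpa [Function.update_of_ne hij] using h1 i (mem_insert_of_mem hi)
        · by_cases hij : i = j
          · subst hij; simpa using hy
          · simpa [Function.update_of_ne hij] using h2 i (by simp [hij, hi])
      have := convexHull_min hsub hc (h1 j (mem_insert_self _ _))
      simpa using this
  exact key univ x (fun i _ => hx i) (fun i hi => absurd (mem_univ i) hi)

/-- If a fixed vector lies in the open cone spanned by each transversal, then the values of an
alternating form at two transversals do not have opposite signs. -/
theorem alternating_mul_pos {ι E : Type*} [Fintype ι] [AddCommGroup E]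
    [Module ℝ E] (f : E [⋀^ι]→ₗ[ℝ] ℝ) (B : ι → Set E) (z : E)
    (hz : ∀ x : ι → E, (∀ i, x i ∈ B i) → ∃ c : ι → ℝ, (∀ i, 0 < c i) ∧ ∑ i, c i • x i = z)
    (hf : ∀ x : ι → E, (∀ i, x i ∈ B i) → f x ≠ 0) (x y : ι → E)
    (hx : ∀ i, x i ∈ B i) (hy : ∀ i, y i ∈ B i) : 0 < f x * f y := by
  classical
  have step : ∀ x : ι → E, (∀ i, x i ∈ B i) → ∀ j, ∀ u ∈ B j,
      0 < f x * f (Function.update x j u) := by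
    intro x hx j u hu
    have hx' : ∀ i, Function.update x j u i ∈ B i := by
      intro i
      by_cases hij : i = j
      · subst hij; simpa using hu
      · simpa [Function.update_of_ne hij] using hx i
    obtain ⟨c, hc, hcz⟩ := hz x hx
    obtain ⟨c', hc', hcz'⟩ := hz _ hx'
    -- Both sides evaluate `f` with `z` in slot `j`, so `c j * f x` equals `c' j` times the value at
    -- the changed transversal.
    have e1 := alternating_update_sum f x j c
    have e2 := alternating_update_sum f (Function.update x j u) j c'
    rw [hcz] at e1
    rw [hcz', Function.update_idem, e1] at e2
    have h3 : 0 < c' j * (f x * f (Function.update x j u)) := by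
      have : c' j * (f x * f (Function.update x j u)) = c j * (f x) ^ 2 := by
        linear_combination (-(f x)) * e2
      rw [this]
      have := hf x hx
      have := hc j
      positivity
    exact pos_of_mul_pos_right h3 (hc' j).le
  have key : ∀ s : Finset ι, 0 < f x * f (s.piecewise y x) := by
    intro s
    induction s using Finset.induction_on with
    | empty => simpa using mul_self_pos.2 (hf x hx)
    | insert j s hj ih =>
      have hp : ∀ i, s.piecewise y x i ∈ B i := by
        intro i
        by_cases hi : i ∈ s <;> simp [hi, hx, hy]
      have h1 := step _ hp j (y j) (hy j)
      rw [← Finset.piecewise_insert] at h1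
      have h2 := mul_pos ih h1
      have h3 := mul_self_pos.2 (hf _ hp)
      refine pos_of_mul_pos_right (a := f (s.piecewise y x) * f (s.piecewise y x)) ?_ h3.le
      convert h2 using 1
      ring
  simpa using key univ

/-! ### Separating and rotating functionals -/

/-- Group a vanishing convex combination of a union by the members of the union. -/
theorem exists_grouped_combination {ι E : Type*} [Fintype ι] [AddCommGroup E]
    [Module ℝ E] (B : ι → Finset E) (hB : ∀ i, (B i).Nonempty) (z : E)
    (h : z ∈ convexHull ℝ (⋃ i, (B i : Set E))) :
    ∃ (m : ι → ℝ) (x : ι → E), (∀ i, x i ∈ convexHull ℝ (B i : Set E)) ∧ (∃ i, m i ≠ 0) ∧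
      ∑ i, m i • x i = z := by
  classical
  have hU : (⋃ i, (B i : Set E)) = ((univ.biUnion B : Finset E) : Set E) := by simp
  rw [hU, Finset.mem_convexHull'] at h
  obtain ⟨w, hw0, hw1, hwz⟩ := h
  have hj : ∀ u : E, ∃ i, u ∈ univ.biUnion B → u ∈ B i := by
    intro u
    by_cases hu : u ∈ univ.biUnion B
    · obtain ⟨i, -, hi⟩ := mem_biUnion.1 hu
      exact ⟨i, fun _ => hi⟩
    · by_contra hne
      push Not at hne
      have hem : IsEmpty ι := ⟨fun i => hu (hne i).1⟩
      simp at hw1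
  choose g hg using hj
  set U := univ.biUnion B with hUdef
  have hx : ∀ i, ∃ x ∈ convexHull ℝ (B i : Set E),
      (∑ u ∈ U with g u = i, w u) • x = ∑ u ∈ U with g u = i, w u • u := by
    intro i
    by_cases h0 : ∑ u ∈ U with g u = i, w u = 0
    · obtain ⟨b, hb⟩ := hB i
      refine ⟨b, subset_convexHull ℝ _ hb, ?_⟩
      have := (Finset.sum_eq_zero_iff_of_nonneg
        (fun u hu => hw0 u (mem_filter.1 hu).1)).1 h0
      rw [h0, zero_smul, Finset.sum_eq_zero]
      intro u hu
      rw [this u hu, zero_smul]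
    · have hnn : 0 ≤ ∑ u ∈ U with g u = i, w u :=
        Finset.sum_nonneg fun u hu => hw0 u (mem_filter.1 hu).1
      refine ⟨(U.filter (g · = i)).centerMass w id, ?_, ?_⟩
      · refine Finset.centerMass_mem_convexHull _ (fun u hu => hw0 u (mem_filter.1 hu).1)
          (lt_of_le_of_ne hnn (Ne.symm h0)) ?_
        intro u hu
        obtain ⟨hu1, hu2⟩ := mem_filter.1 hu
        have := hg u hu1
        rw [hu2] at this
        simpa using this
      · rw [Finset.centerMass, smul_inv_smul₀ h0]
        simp
  choose x hx1 hx2 using hx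
  refine ⟨fun i => ∑ u ∈ U with g u = i, w u, x, hx1, ?_, ?_⟩
  · by_contra hne
    push Not at hne
    rw [← Finset.sum_fiberwise (s := U) (g := g)] at hw1
    simp [hne] at hw1
  · simp only [hx2]
    exact (Finset.sum_fiberwise U g _).trans hwz

/-- If the members of each transversal of `B` positively span a fixed vector and are linearly
independent, then a linear functional is positive on all the sets `B i`. -/
theorem exists_inner_pos_of_transversals {ι E : Type*} [Fintype ι]
    [NormedAddCommGroup E] [InnerProductSpace ℝ E] [FiniteDimensional ℝ E]
    (hcard : Fintype.card ι = Module.finrank ℝ E)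
    (B : ι → Finset E) (hB : ∀ i, (B i).Nonempty) (z : E)
    (hz : ∀ x : ι → E, (∀ i, x i ∈ B i) → ∃ c : ι → ℝ, (∀ i, 0 < c i) ∧ ∑ i, c i • x i = z)
    (hli : ∀ x : ι → E, (∀ i, x i ∈ B i) → LinearIndependent ℝ x) :
    ∃ n : E, ∀ i, ∀ u ∈ B i, 0 < inner ℝ n u := by
  classical
  have hzero : (0 : E) ∉ convexHull ℝ (⋃ i, (B i : Set E)) := by
    intro h0
    obtain ⟨m, x, hx, ⟨j, hj⟩, hsum⟩ := exists_grouped_combination B hB 0 h0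
    let b : Module.Basis ι ℝ E :=
      (Module.finBasis ℝ E).reindex (Fintype.equivOfCardEq (by simp [hcard]))
    choose p hp using hB
    have hdet : ∀ y : ι → E, (∀ i, y i ∈ B i) → b.det y ≠ 0 := by
      intro y hy
      have hl := hli y hy
      exact ((Module.Basis.is_basis_iff_det b).1
        ⟨hl, hl.span_eq_top_of_card_eq_finrank' hcard⟩).ne_zero
    -- The factor `b.det p` normalises the common sign to be positive.
    have hpos := multilinear_pos_of_mem_convexHull (b.det p • b.det).toMultilinearMap
      (fun i => (B i : Set E))
      (fun y hy => alternating_mul_pos b.det (fun i => (B i : Set E)) z hz hdet p y hp hy) x hx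
    have hne : b.det x ≠ 0 := by
      intro h
      have : (b.det p • b.det).toMultilinearMap x = b.det p * b.det x := rfl
      rw [this, h, mul_zero] at hpos
      exact lt_irrefl _ hpos
    have h1 := alternating_update_sum b.det x j m
    rw [hsum, AlternatingMap.map_update_zero] at h1
    exact mul_ne_zero hj hne h1.symm
  have hfin : (⋃ i, (B i : Set E)).Finite := Set.finite_iUnion fun i => (B i).finite_toSet
  obtain ⟨f, u, hu, hf⟩ := geometric_hahn_banach_point_closed (convex_convexHull ℝ _)
    (hfin.isClosed_convexHull ℝ) hzero
  rw [map_zero] at hu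
  refine ⟨(InnerProductSpace.toDual ℝ E).symm f, fun i v hv => ?_⟩
  rw [InnerProductSpace.toDual_symm_apply]
  exact hu.trans (hf v (subset_convexHull ℝ _ (Set.mem_iUnion.2 ⟨i, hv⟩)))

/-- A functional that is nonnegative on a finite spanning set `U` and positive at `w` can be
rotated until it vanishes on `finrank - 1` members of `U`. -/
theorem exists_inner_nonneg_many_zeros {E : Type*}
    [NormedAddCommGroup E] [InnerProductSpace ℝ E] [FiniteDimensional ℝ E] [DecidableEq E]
    (U : Finset E) (hU : Submodule.span ℝ (U : Set E) = ⊤) (w : E) (n : E)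
    (hn : ∀ u ∈ U, 0 ≤ inner ℝ n u) (hw : 0 < inner ℝ n w) :
    ∃ n' : E, (∀ u ∈ U, 0 ≤ inner ℝ n' u) ∧ 0 < inner ℝ n' w ∧
      ∃ Z ⊆ U, (∀ u ∈ Z, inner ℝ n' u = 0) ∧ Module.finrank ℝ E ≤ Z.card + 1 := by
  let P : Finset E → Prop := fun Z => ∃ n' : E, (∀ u ∈ U, 0 ≤ inner ℝ n' u) ∧
    0 < inner ℝ n' w ∧ ∀ u ∈ Z, inner ℝ n' u = 0
  classical
  obtain ⟨Z, hZ, hmax⟩ := Finset.exists_max_image (U.powerset.filter P) Finset.card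
    ⟨∅, by simpa [P] using ⟨n, hn, hw⟩⟩
  obtain ⟨hZU, n', hn', hw', hZ0⟩ := mem_filter.1 hZ
  rw [mem_powerset] at hZU
  refine ⟨n', hn', hw', Z, hZU, hZ0, ?_⟩
  by_contra hlt
  push Not at hlt
  -- With too few zeros there is a direction `m` orthogonal to `w` and `Z`; moving along it keeps
  -- the zeros and the value at `w`.
  have hspan : Submodule.span ℝ ((insert w Z : Finset E) : Set E) ≠ ⊤ := by
    intro htop
    have h1 := finrank_span_finset_le_card (R := ℝ) (insert w Z)
    have h2 := Finset.card_insert_le w Z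
    rw [Set.finrank, htop, finrank_top] at h1
    omega
  rw [Ne, ← Submodule.orthogonal_eq_bot_iff, ← Ne, Submodule.ne_bot_iff] at hspan
  obtain ⟨m, hm, hm0⟩ := hspan
  have hmz : ∀ v ∈ insert w Z, inner ℝ m v = 0 := fun v hv =>
    (Submodule.mem_orthogonal' _ _).1 hm v (Submodule.subset_span hv)
  obtain ⟨v, hv, hvm⟩ : ∃ v ∈ U, inner ℝ m v ≠ 0 := by
    by_contra hne
    push Not at hne
    apply hm0
    have : m ∈ (Submodule.span ℝ (U : Set E))ᗮ := by
      rw [Submodule.mem_orthogonal']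
      intro u hu
      induction hu using Submodule.span_induction with
      | mem x hx => exact hne x hx
      | zero => simp
      | add x y _ _ hx hy => simp [inner_add_right, hx, hy]
      | smul a x _ hx => simp [inner_smul_right, hx]
    simpa [hU] using this
  obtain ⟨m, hmz, v, hv, hvm⟩ :
      ∃ m : E, (∀ u ∈ insert w Z, inner ℝ m u = 0) ∧ ∃ v ∈ U, inner ℝ m v < 0 := by
    rcases lt_or_gt_of_ne hvm with h | h
    · exact ⟨m, hmz, v, hv, h⟩
    · exact ⟨-m, fun u hu => by simp [hmz u hu], v, hv, by simpa using h⟩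
  -- The least ratio is the first time a value on `U` reaches zero; `y` then enlarges the maximal
  -- `Z`.
  obtain ⟨y, hy, hymin⟩ := Finset.exists_min_image (U.filter fun u => inner ℝ m u < 0)
    (fun u => inner ℝ n' u / (-inner ℝ m u)) ⟨v, by simp [hv, hvm]⟩
  obtain ⟨hyU, hym⟩ := mem_filter.1 hy
  set t := inner ℝ n' y / (-inner ℝ m y) with ht
  have ht0 : 0 ≤ t := div_nonneg (hn' y hyU) (by linarith)
  have hyZ : y ∉ Z := fun h => hym.ne (hmz y (mem_insert_of_mem h))
  have hin : ∀ u, inner ℝ (n' + t • m) u = inner ℝ n' u + t * inner ℝ m u := by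
    intro u
    rw [inner_add_left, real_inner_smul_left]
  have hP : P (insert y Z) := by
    refine ⟨n' + t • m, fun u hu => ?_, ?_, fun u hu => ?_⟩
    · rw [hin]
      rcases lt_or_ge (inner ℝ m u) 0 with h | h
      · have := hymin u (by simp [hu, h])
        rw [le_div_iff₀ (by linarith)] at this
        linarith
      · have := mul_nonneg ht0 h
        have := hn' u hu
        linarith
    · rw [hin, hmz w (mem_insert_self _ _)]
      simpa using hw'
    · rw [hin]
      rcases mem_insert.1 hu with rfl | hu
      · rw [ht]
        have := hym.ne
        rw [div_neg, neg_mul, div_mul_cancel₀ _ this, add_neg_cancel]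
      · rw [hZ0 u hu, hmz u (mem_insert_of_mem hu)]
        simp
  have := hmax (insert y Z) (mem_filter.2 ⟨mem_powerset.2 (insert_subset hyU hZU), hP⟩)
  rw [card_insert_of_notMem hyZ] at this
  omega

/-! ### Positive dependences and intersections of halfspaces -/

/-- Relative to a spanning family with a positive dependence, each vector has nonpositive
coefficients one of which vanishes. -/
theorem exists_nonpos_repr {ι E : Type*} [Fintype ι] [Nonempty ι] [AddCommGroup E] [Module ℝ E]
    (v : ι → E) (hv : Submodule.span ℝ (Set.range v) = ⊤) (c : ι → ℝ) (hc : ∀ i, 0 < c i)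
    (hcv : ∑ i, c i • v i = 0) (x : E) :
    ∃ b : ι → ℝ, (∀ i, b i ≤ 0) ∧ (∃ k, b k = 0) ∧ ∑ i, b i • v i = x := by
  obtain ⟨a, rfl⟩ := (Submodule.mem_span_range_iff_exists_fun ℝ).1 (hv ▸ Submodule.mem_top : x ∈ _)
  -- Subtracting the largest ratio `a k / c k` times the dependence makes all coefficients
  -- nonpositive.
  obtain ⟨k, -, hk⟩ := Finset.exists_max_image univ (fun i => a i / c i) univ_nonempty
  refine ⟨fun i => a i - a k / c k * c i, fun i => ?_, ⟨k, ?_⟩, ?_⟩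
  · have := (div_le_iff₀ (hc i)).1 (hk i (mem_univ _))
    simpa using this
  · simp [(hc k).ne']
  · simp [sub_smul, mul_smul, ← Finset.smul_sum, hcv]

/-- Halfspaces whose normals are nonnegative on all points of a positively dependent spanning
family but the one of the same index, and positive on the cyclically next one, meet only in the
origin. -/
theorem eq_zero_of_cyclic_pos {d : ℕ} {E : Type*} [NormedAddCommGroup E]
    [InnerProductSpace ℝ E]
    (p : Fin (d + 1) → E) (hp : Submodule.span ℝ (Set.range p) = ⊤) (c : Fin (d + 1) → ℝ)
    (hc : ∀ i, 0 < c i) (hcp : ∑ i, c i • p i = 0) (n : Fin (d + 1) → E)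
    (hn : ∀ k i, i ≠ k → 0 ≤ inner ℝ (n k) (p i)) (hnext : ∀ k, 0 < inner ℝ (n k) (p (k + 1)))
    (x : E) (hx : ∀ k, 0 ≤ inner ℝ (n k) x) : x = 0 := by
  obtain ⟨b, hb, ⟨k, hk⟩, rfl⟩ := exists_nonpos_repr p hp c hc hcp x
  have step : ∀ k, b k = 0 → b (k + 1) = 0 := by
    intro k hk
    have hterm : ∀ i ∈ univ, b i * inner ℝ (n k) (p i) ≤ 0 := by
      intro i _
      by_cases hik : i = k
      · simp [hik, hk]
      · exact mul_nonpos_of_nonpos_of_nonneg (hb i) (hn k i hik)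
    have h0 := hx k
    rw [inner_sum] at h0
    simp only [real_inner_smul_right] at h0
    have := (Finset.sum_eq_zero_iff_of_nonpos hterm).1
      (le_antisymm (Finset.sum_nonpos hterm) h0) (k + 1) (mem_univ _)
    exact (mul_eq_zero.1 this).resolve_right (hnext k).ne'
  have all : ∀ m : ℕ, b (k + Fin.ofNat (d + 1) m) = 0 := by
    intro m
    induction m with
    | zero => simpa using hk
    | succ m ih =>
      have := step _ ih
      have hs : Fin.ofNat (d + 1) m + 1 = Fin.ofNat (d + 1) (m + 1) := by
        ext
        simp [Fin.val_add]
      rwa [add_assoc, hs] at this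
  refine Finset.sum_eq_zero fun i _ => ?_
  have := all (i - k).val
  rw [Fin.ofNat_val_eq_self, add_sub_cancel] at this
  rw [this, zero_smul]

/-- `finrank + 1` vectors whose halfspaces meet only in the origin are positively dependent
and span. -/
theorem exists_pos_dependence {d : ℕ} {E : Type*} [NormedAddCommGroup E]
    [InnerProductSpace ℝ E] [FiniteDimensional ℝ E] (hd : Module.finrank ℝ E = d)
    (n : Fin (d + 1) → E) (h : ∀ x, (∀ k, 0 ≤ inner ℝ (n k) x) → x = 0) :
    Submodule.span ℝ (Set.range n) = ⊤ ∧
      ∃ c : Fin (d + 1) → ℝ, (∀ i, 0 < c i) ∧ ∑ i, c i • n i = 0 := by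
  have hspan : Submodule.span ℝ (Set.range n) = ⊤ := by
    rw [← Submodule.orthogonal_eq_bot_iff, Submodule.eq_bot_iff]
    intro x hx
    refine h x fun k => ?_
    rw [(Submodule.mem_orthogonal _ _).1 hx _ (Submodule.subset_span ⟨k, rfl⟩)]
  refine ⟨hspan, ?_⟩
  have hdep : ¬ LinearIndependent ℝ n := by
    intro hl
    have := hl.fintype_card_le_finrank
    simp [hd] at this
  obtain ⟨c, hc, i₀, hi₀⟩ := Fintype.not_linearIndependent_iff.1 hdep
  let T : E →ₗ[ℝ] (Fin (d + 1) → ℝ) := LinearMap.pi fun k => (innerₛₗ ℝ (n k))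
  let φ : (Fin (d + 1) → ℝ) →ₗ[ℝ] ℝ := ∑ i, c i • LinearMap.proj i
  have hφ : ∀ y, φ y = ∑ i, c i * y i := by intro y; simp [φ]
  have hT : ∀ x k, T x k = inner ℝ (n k) x := fun x k => rfl
  have hker : LinearMap.ker T = ⊥ := by
    rw [Submodule.eq_bot_iff]
    intro x hx
    refine h x fun k => ?_
    rw [← hT, LinearMap.mem_ker.1 hx]
    simp
  have hφ0 : φ ≠ 0 := by
    intro h0
    have := hφ (Pi.single i₀ 1)
    rw [h0] at this
    simp [Pi.single_apply] at this
    exact hi₀ this.symm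
  have hle : LinearMap.range T ≤ LinearMap.ker φ := by
    rintro _ ⟨x, rfl⟩
    rw [LinearMap.mem_ker, hφ]
    simp only [hT, ← real_inner_smul_left, ← sum_inner, hc, inner_zero_left]
  -- Both have dimension `d`, so a nonnegative vector in the kernel of `φ` comes from some `x` in
  -- all halfspaces, and is zero.
  have heq : LinearMap.range T = LinearMap.ker φ := by
    refine Submodule.eq_of_le_of_finrank_eq hle ?_
    have h1 := Module.Dual.finrank_ker_add_one_of_ne_zero hφ0
    rw [LinearMap.finrank_range_of_inj (LinearMap.ker_eq_bot.1 hker), hd]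
    simp at h1
    omega
  have hpos : ∀ y : Fin (d + 1) → ℝ, (∀ i, 0 ≤ y i) → ∑ i, c i * y i = 0 → y = 0 := by
    intro y hy hcy
    have : y ∈ LinearMap.range T := by rw [heq, LinearMap.mem_ker, hφ, hcy]
    obtain ⟨x, rfl⟩ := this
    rw [h x hy, map_zero]
  have hne : ∀ i, c i ≠ 0 := by
    intro i hi
    have := congrFun (hpos (Pi.single i 1)
      (fun j => by by_cases hj : j = i <;> simp [hj])
      (by simp [Pi.single_apply, hi])) i
    simp at this
  have hmul : ∀ i, 0 < c i₀ * c i := by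
    intro i
    by_contra hlt
    have hlt : c i₀ * c i < 0 :=
      lt_of_le_of_ne (not_lt.1 hlt) (mul_ne_zero (hne _) (hne _))
    have hii : i ≠ i₀ := by
      rintro rfl
      exact absurd (mul_self_nonneg (c i)) (not_le.2 hlt)
    -- Coefficients of opposite sign would give this nonzero nonnegative vector in the kernel.
    have := congrFun (hpos (Pi.single i₀ (-(c i₀ * c i)) + Pi.single i (c i₀ * c i₀))
      (fun j => ?_) ?_) i
    · simp [hii, hi₀] at this
    · have := mul_self_nonneg (c i₀)
      simp only [Pi.add_apply, Pi.single_apply]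
      split_ifs <;> linarith
    · simp only [Pi.add_apply, mul_add, Finset.sum_add_distrib, Pi.single_apply, mul_ite,
        mul_zero, Finset.sum_ite_eq', mem_univ, if_true]
      ring
  refine ⟨fun i => c i₀ * c i, hmul, ?_⟩
  simp only [mul_smul, ← Finset.smul_sum, hc, smul_zero]

/-- If `v i` lies in all halfspaces with normals `n j`, `j ≠ i`, and these halfspaces meet only in
the origin, then no functional is positive on all `v i`. -/
theorem exists_inner_nonpos {d : ℕ} {E : Type*} [NormedAddCommGroup E]
    [InnerProductSpace ℝ E] [FiniteDimensional ℝ E] (hd : Module.finrank ℝ E = d)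
    (n v : Fin (d + 1) → E) (h : ∀ x, (∀ k, 0 ≤ inner ℝ (n k) x) → x = 0)
    (hv : ∀ i j, j ≠ i → 0 ≤ inner ℝ (n j) (v i)) (m : E) : ∃ i, inner ℝ m (v i) ≤ 0 := by
  obtain ⟨hspan, c, hc, hcn⟩ := exists_pos_dependence hd n h
  obtain ⟨b, hb, ⟨k, hk⟩, rfl⟩ := exists_nonpos_repr n hspan c hc hcn m
  refine ⟨k, ?_⟩
  rw [sum_inner]
  refine Finset.sum_nonpos fun i _ => ?_
  rw [real_inner_smul_left]
  by_cases hik : i = k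
  · simp [hik, hk]
  · exact mul_nonpos_of_nonpos_of_nonneg (hb i) (hv k i hik)

/-! ### General position and convex weights -/

/-- In general position, the differences of at most `d` points of `S` with `q` are linearly
independent. -/
theorem InGeneralPosition.linearIndependent_sub {d : ℕ} {S : Set (EuclideanSpace ℝ (Fin d))}
    {q : EuclideanSpace ℝ (Fin d)} (hgen : InGeneralPosition (insert q S)) (hq : q ∉ S)
    {ι : Type*} [Fintype ι] (hι : Fintype.card ι ≤ d) (x : ι → EuclideanSpace ℝ (Fin d))
    (hinj : Function.Injective x) (hx : ∀ i, x i ∈ S) :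
    LinearIndependent ℝ fun i => x i - q := by
  classical
  have hcard : (insert q (univ.image x)).card ≤ d + 1 :=
    (card_insert_le _ _).trans (Nat.succ_le_succ (card_image_le.trans hι))
  have haff := hgen (insert q (univ.image x)) (by
    intro y hy
    rw [coe_insert] at hy
    rcases hy with rfl | hy
    · exact Set.mem_insert _ _
    · obtain ⟨i, -, rfl⟩ := mem_image.1 (mem_coe.1 hy)
      exact Set.mem_insert_of_mem _ (hx i)) hcard
  have hli := (affineIndependent_iff_linearIndependent_vsub ℝ _
    (⟨q, mem_insert_self _ _⟩ : ↥(insert q (univ.image x)))).1 haff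
  refine hli.comp (fun i => ⟨⟨x i, mem_insert_of_mem (mem_image_of_mem x (mem_univ i))⟩,
    fun h => hq ?_⟩) fun i j hij => hinj ?_
  · have : x i = q := congrArg Subtype.val h
    exact this ▸ hx i
  · exact congrArg (fun y => y.1.1) hij

/-- In general position, a hyperplane through `q` contains at most `d - 1` points of `S`. -/
theorem InGeneralPosition.card_filter_lt {d : ℕ} {S : Finset (EuclideanSpace ℝ (Fin d))}
    {q : EuclideanSpace ℝ (Fin d)}
    (hgen : InGeneralPosition (insert q (S : Set (EuclideanSpace ℝ (Fin d))))) (hq : q ∉ S)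
    (n : EuclideanSpace ℝ (Fin d)) (hn : n ≠ 0) :
    (S.filter fun x => inner ℝ n (x - q) = 0).card < d := by
  by_contra hge
  obtain ⟨T, hT, hTd⟩ := exists_subset_card_eq (not_lt.1 hge)
  have hli := hgen.linearIndependent_sub (by simpa using hq) (ι := T) (by simp [hTd])
    (fun x => x.1) Subtype.val_injective fun x => (mem_filter.1 (hT x.2)).1
  have hspan := hli.span_eq_top_of_card_eq_finrank' (by simp [hTd])
  have hmem : n ∈ (Submodule.span ℝ (Set.range fun x : T => x.1 - q))ᗮ := by
    rw [Submodule.mem_orthogonal']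
    intro u hu
    induction hu using Submodule.span_induction with
    | mem x hx =>
      obtain ⟨y, rfl⟩ := hx
      exact (mem_filter.1 (hT y.2)).2
    | zero => simp
    | add x y _ _ hx hy => simp [inner_add_right, hx, hy]
    | smul a x _ hx => simp [inner_smul_right, hx]
  rw [hspan] at hmem
  exact hn (by simpa using hmem)

/-- A point of the convex hull of a family is the origin of a convex dependence. -/
theorem exists_weights_of_mem_convexHull_range {ι E : Type*} [Fintype ι] [AddCommGroup E]
    [Module ℝ E] (p : ι → E) (q : E) (h : q ∈ convexHull ℝ (Set.range p)) :
    ∃ w : ι → ℝ, (∀ i, 0 ≤ w i) ∧ ∑ i, w i = 1 ∧ ∑ i, w i • (p i - q) = 0 := by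
  classical
  have hr : Set.range p = Fintype.linearCombination ℝ p '' Set.range fun i => Pi.single i 1 := by
    rw [← Set.range_comp]
    congr 1
    ext i
    simp
  rw [hr, ← LinearMap.image_convexHull, convexHull_rangle_single_eq_stdSimplex] at h
  obtain ⟨w, ⟨hw0, hw1⟩, hw⟩ := h
  rw [Fintype.linearCombination_apply] at hw
  refine ⟨w, hw0, hw1, ?_⟩
  simp only [smul_sub, Finset.sum_sub_distrib, hw, ← Finset.sum_smul, hw1, one_smul, sub_self]

/-- A nonnegative dependence is positive if all proper subfamilies are linearly independent. -/
theorem weights_pos {d : ℕ} {E : Type*} [AddCommGroup E] [Module ℝ E] (v : Fin (d + 1) → E)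
    (hli : ∀ k : Fin (d + 1), LinearIndependent ℝ fun i => v (k.succAbove i))
    (w : Fin (d + 1) → ℝ) (hw0 : ∀ i, 0 ≤ w i) (hw1 : ∑ i, w i = 1)
    (hw : ∑ i, w i • v i = 0) (k : Fin (d + 1)) : 0 < w k := by
  refine lt_of_le_of_ne (hw0 k) fun hk => ?_
  rw [Fin.sum_univ_succAbove _ k, ← hk, zero_smul, zero_add] at hw
  have := Fintype.linearIndependent_iff.1 (hli k) _ hw
  rw [Fin.sum_univ_succAbove _ k, ← hk, Finset.sum_eq_zero fun i _ => this i] at hw1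
  simp at hw1

/-! ### From halfspaces to enclosing -/

/-- Halfspaces as in the characterization force enclosing. -/
theorem encloses_of_halfspaces {d : ℕ} (q : EuclideanSpace ℝ (Fin d))
    (A : Fin (d + 1) → Finset (EuclideanSpace ℝ (Fin d))) (hqA : ∀ i, q ∉ A i)
    (H : Fin (d + 1) → ClosedHalfspace d) (hqH : ∀ i, q ∈ (H i).boundary)
    (hAH : ∀ i, (A i : Set (EuclideanSpace ℝ (Fin d))) ⊆
      ⋂ (j : Fin (d + 1)) (_ : j ≠ i), (H j).carrier)
    (hH : (⋂ i, (H i).carrier) = {q}) : Encloses A q := by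
  have hmem : ∀ i j, j ≠ i → ∀ x ∈ A i, x ∈ (H j).carrier := fun i j hij x hx =>
    Set.mem_iInter₂.1 (hAH i hx) j hij
  have hcar : ∀ j x, x ∈ (H j).carrier ↔ 0 ≤ inner ℝ (H j).normal (x - q) := by
    intro j x
    have : inner ℝ (H j).normal q = (H j).offset := hqH j
    rw [inner_sub_right, this, sub_nonneg]
    rfl
  refine ⟨fun i j hij => ?_, fun p hp => ?_⟩
  · rw [Finset.disjoint_left]
    intro x hxi hxj
    have hx : x ∈ ⋂ i, (H i).carrier := by
      refine Set.mem_iInter.2 fun k => ?_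
      by_cases hk : k = i
      · exact hmem j k (hk ▸ hij) x hxj
      · exact hmem i k hk x hxi
    rw [hH] at hx
    exact hqA i (Set.mem_singleton_iff.1 hx ▸ hxi)
  · by_contra hnot
    obtain ⟨f, u, hu, hf⟩ := geometric_hahn_banach_point_closed (convex_convexHull ℝ _)
      ((Set.finite_range p).isClosed_convexHull ℝ) hnot
    obtain ⟨i, hi⟩ := exists_inner_nonpos (E := EuclideanSpace ℝ (Fin d)) (by simp)
      (fun k => (H k).normal) (fun i => p i - q)
      (fun x hx => by
        have : x + q ∈ ⋂ i, (H i).carrier :=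
          Set.mem_iInter.2 fun k => (hcar k _).2 (by simpa using hx k)
        rw [hH] at this
        simpa using this)
      (fun i j hij => (hcar j _).1 (hmem i j hij _ (hp i)))
      ((InnerProductSpace.toDual ℝ _).symm f)
    rw [InnerProductSpace.toDual_symm_apply, map_sub] at hi
    have := hf (p i) (subset_convexHull ℝ _ ⟨i, rfl⟩)
    linarith

/-! ### From enclosing to halfspaces -/

/-- For sets in general position that enclose `q` and points `p i ∈ A i`, there are normals whose
hyperplanes through `q` satisfy the incidence and containment conditions and are positive at a
prescribed further point. -/
theorem exists_normal_of_encloses {d : ℕ}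
    (S : Finset (EuclideanSpace ℝ (Fin d))) (q : EuclideanSpace ℝ (Fin d)) (hq : q ∉ S)
    (hgen : InGeneralPosition (insert q (S : Set (EuclideanSpace ℝ (Fin d)))))
    (A : Fin (d + 1) → Finset (EuclideanSpace ℝ (Fin d))) (hAS : ∀ i, A i ⊆ S)
    (hA : ∀ i, (A i).Nonempty)
    (hpos : ∀ p : Fin (d + 1) → EuclideanSpace ℝ (Fin d), (∀ i, p i ∈ A i) →
      ∃ c : Fin (d + 1) → ℝ, (∀ i, 0 < c i) ∧ ∑ i, c i • (p i - q) = 0)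
    (hli : ∀ p : Fin (d + 1) → EuclideanSpace ℝ (Fin d), (∀ i, p i ∈ A i) →
      ∀ k : Fin (d + 1), LinearIndependent ℝ fun i => p (k.succAbove i) - q)
    (k l : Fin (d + 1)) (hkl : l ≠ k) (w : EuclideanSpace ℝ (Fin d)) (hw : w ∈ A l) :
    ∃ n : EuclideanSpace ℝ (Fin d), (∀ i, i ≠ k → ∀ u ∈ A i, 0 ≤ inner ℝ n (u - q)) ∧
      0 < inner ℝ n (w - q) ∧ (S.filter fun x => inner ℝ n (x - q) = 0).card = d - 1 := by
  classical
  obtain ⟨z, hz⟩ := hA k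
  choose p hp using hA
  let B : Fin d → Finset (EuclideanSpace ℝ (Fin d)) :=
    fun i => (A (k.succAbove i)).image (· - q)
  have hlift : ∀ x : Fin d → EuclideanSpace ℝ (Fin d), (∀ i, x i ∈ B i) →
      ∃ y : Fin (d + 1) → EuclideanSpace ℝ (Fin d), (∀ i, y i ∈ A i) ∧ y k = z ∧
        ∀ i, y (k.succAbove i) - q = x i := by
    intro x hx
    choose y hy hyx using fun i => mem_image.1 (hx i)
    refine ⟨k.insertNth z y, fun i => ?_, by simp, fun i => by simpa using hyx i⟩
    cases i using Fin.succAboveCases k with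
    | x => simpa using hz
    | p i => simpa using hy i
  obtain ⟨n, hn⟩ := exists_inner_pos_of_transversals (by simp) B
    (fun i => ⟨p (k.succAbove i) - q, mem_image_of_mem _ (hp _)⟩) (-(z - q))
    (fun x hx => by
      obtain ⟨y, hy, hyk, hyx⟩ := hlift x hx
      obtain ⟨c, hc, hcy⟩ := hpos y hy
      rw [Fin.sum_univ_succAbove _ k, hyk] at hcy
      simp only [hyx] at hcy
      refine ⟨fun i => (c k)⁻¹ * c (k.succAbove i),
        fun i => mul_pos (inv_pos.2 (hc k)) (hc _), ?_⟩
      simp only [mul_smul, ← Finset.smul_sum]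
      rw [← neg_eq_of_add_eq_zero_right hcy, smul_neg, inv_smul_smul₀ (hc k).ne'])
    (fun x hx => by
      obtain ⟨y, hy, -, hyx⟩ := hlift x hx
      simpa only [hyx] using hli y hy k)
  have hnA : ∀ i, i ≠ k → ∀ u ∈ A i, 0 < inner ℝ n (u - q) := by
    intro i hik u hu
    obtain ⟨j, rfl⟩ := Fin.exists_succAbove_eq hik
    exact hn j _ (mem_image_of_mem _ hu)
  have hU : Submodule.span ℝ ((univ.biUnion B : Finset _) : Set (EuclideanSpace ℝ (Fin d)))
      = ⊤ := by
    rw [eq_top_iff, ← (hli p hp k).span_eq_top_of_card_eq_finrank' (by simp)]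
    refine Submodule.span_mono ?_
    rintro _ ⟨i, rfl⟩
    exact mem_coe.2 (mem_biUnion.2 ⟨i, mem_univ _, mem_image_of_mem _ (hp _)⟩)
  obtain ⟨n', hn', hw', Z, hZU, hZ0, hZ⟩ := exists_inner_nonneg_many_zeros (univ.biUnion B) hU
    (w - q) n
    (fun u hu => by
      obtain ⟨i, -, hi⟩ := mem_biUnion.1 hu
      exact (hn i u hi).le)
    (hnA l hkl w hw)
  refine ⟨n', fun i hik u hu => ?_, hw', ?_⟩
  · obtain ⟨j, rfl⟩ := Fin.exists_succAbove_eq hik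
    exact hn' _ (mem_biUnion.2 ⟨j, mem_univ _, mem_image_of_mem _ hu⟩)
  · have hn0 : n' ≠ 0 := by
      rintro rfl
      simp at hw'
    -- General position allows at most `d - 1` zeros and the rotation gives at least `d - 1`.
    have hlt := hgen.card_filter_lt hq n' hn0
    have hle : Z.card ≤ (S.filter fun x => inner ℝ n' (x - q) = 0).card := by
      rw [← card_image_of_injective Z (f := (· + q)) (add_left_injective q)]
      refine card_le_card fun x hx => ?_
      obtain ⟨y, hy, rfl⟩ := mem_image.1 hx
      obtain ⟨i, -, hi⟩ := mem_biUnion.1 (hZU hy)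
      obtain ⟨a, ha, rfl⟩ := mem_image.1 hi
      refine mem_filter.2 ⟨?_, by simpa using hZ0 _ hy⟩
      simpa using hAS _ ha
    rw [finrank_euclideanSpace_fin] at hZ
    omega

end EnclosingDepth

theorem mainTheorem2 (d : ℕ) (hd : 1 ≤ d)
    (S : Finset (EuclideanSpace ℝ (Fin d))) (q : EuclideanSpace ℝ (Fin d))
    (hq : q ∉ S)
    (hgen : EnclosingDepth.InGeneralPosition
      (insert q (S : Set (EuclideanSpace ℝ (Fin d)))))
    (A : Fin (d + 1) → Finset (EuclideanSpace ℝ (Fin d)))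
    (hAS : ∀ i, A i ⊆ S) (hA : ∀ i, (A i).Nonempty) :
    EnclosingDepth.Encloses A q ↔
      ∃ H : Fin (d + 1) → EnclosingDepth.ClosedHalfspace d,
        (∀ i, q ∈ (H i).boundary ∧
          ((S : Set (EuclideanSpace ℝ (Fin d))) ∩ (H i).boundary).ncard = d - 1) ∧
        (∀ i, (A i : Set (EuclideanSpace ℝ (Fin d))) ⊆
          ⋂ (j : Fin (d + 1)) (_ : j ≠ i), (H j).carrier) ∧
        (⋂ i, (H i).carrier) = {q} := by
  constructor
  · rintro ⟨hdisj, hconv⟩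
    have hli : ∀ p : Fin (d + 1) → EuclideanSpace ℝ (Fin d), (∀ i, p i ∈ A i) →
        ∀ k : Fin (d + 1), LinearIndependent ℝ fun i => p (k.succAbove i) - q := by
      intro p hp k
      refine hgen.linearIndependent_sub (by simpa using hq) (by simp)
        (fun i => p (k.succAbove i)) (fun i j hij => ?_) fun i => hAS _ (hp _)
      by_contra hne
      have := hdisj _ _ (fun h => hne (Fin.succAbove_right_injective (p := k) h))
      exact Finset.disjoint_left.1 this (hp (k.succAbove i))
        ((show p (k.succAbove i) = p (k.succAbove j) from hij) ▸ hp (k.succAbove j))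
    have hpos : ∀ p : Fin (d + 1) → EuclideanSpace ℝ (Fin d), (∀ i, p i ∈ A i) →
        ∃ c : Fin (d + 1) → ℝ, (∀ i, 0 < c i) ∧ ∑ i, c i • (p i - q) = 0 := by
      intro p hp
      obtain ⟨w, hw0, hw1, hw⟩ :=
        EnclosingDepth.exists_weights_of_mem_convexHull_range p q (hconv p hp)
      exact ⟨w, EnclosingDepth.weights_pos (fun i => p i - q) (hli p hp) w hw0 hw1 hw, hw⟩
    choose p hp using id hA
    -- The cyclic successor differs from `k` because `d ≥ 1`.
    have hsucc : ∀ k : Fin (d + 1), k + 1 ≠ k := by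
      intro k h
      obtain ⟨e, rfl⟩ := Nat.exists_eq_add_of_le' hd
      simp at h
    choose n hn hnext hcard using fun k => EnclosingDepth.exists_normal_of_encloses S q hq
      hgen A hAS hA hpos hli k (k + 1) (hsucc k) (p (k + 1)) (hp (k + 1))
    have hn0 : ∀ k, n k ≠ 0 := by
      intro k h
      have := hnext k
      simp [h] at this
    refine ⟨fun k => ⟨n k, hn0 k, inner ℝ (n k) q⟩, fun k => ⟨rfl, ?_⟩, fun i x hx => ?_, ?_⟩
    · rw [← hcard k, ← Set.ncard_coe_finset]
      congr 1
      ext x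
      simp [EnclosingDepth.ClosedHalfspace.boundary, inner_sub_right, sub_eq_zero]
    · refine Set.mem_iInter₂.2 fun j hji => ?_
      have := hn j i hji.symm x hx
      rw [inner_sub_right, sub_nonneg] at this
      exact this
    · refine Set.Subset.antisymm (fun x hx => ?_) ?_
      · obtain ⟨c, hc, hcp⟩ := hpos p hp
        have hspan : Submodule.span ℝ (Set.range fun i => p i - q) = ⊤ := by
          rw [eq_top_iff, ← (hli p hp 0).span_eq_top_of_card_eq_finrank' (by simp)]
          refine Submodule.span_mono ?_
          rintro _ ⟨i, rfl⟩
          exact ⟨_, rfl⟩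
        refine sub_eq_zero.1 (EnclosingDepth.eq_zero_of_cyclic_pos (fun i => p i - q) hspan c hc
          hcp n (fun k i hik => hn k i hik _ (hp i)) hnext (x - q) fun k => ?_)
        rw [inner_sub_right, sub_nonneg]
        exact Set.mem_iInter.1 hx k
      · refine Set.singleton_subset_iff.2 (Set.mem_iInter.2 fun k => ?_)
        exact le_refl (inner ℝ (n k) q)
  · rintro ⟨H, hH1, hH2, hH3⟩
    exact EnclosingDepth.encloses_of_halfspaces q A (fun i h => hq (hAS i h)) H
      (fun i => (hH1 i).1) hH2 hH3
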